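/- \textbf{Conventions.} Boolean algebras may satisfy $0=1$; $a^*$ denotes the complement of $a$. For a complete Boolean homomorphism $\varphi:A\to B$ (preserving all joins and meets) between complete Boolean algebras, $\varphi_\Lambda:B\to A$ denotes its lower adjoint: $b\le\varphi(a)\iff\varphi_\Lambda(b)\le a$. \textbf{Local contact algebras.} A contact relation on a Boolean algebra $B$ is a relation $\rho$ such that: $a\neq 0\Rightarrow a\rho a$; $a\rho b\Rightarrow a\ne0\ne b$; $a\rho b\Rightarrow b\rho a$; $a\rho(b\vee c)\iff(a\rho b$ or $a\rho c)$. Write $a\ll_\rho b$ if not $a\rho b^*$. A complete local contact algebra (CLCA) $(B,\rho,\mathbb B)$ is a complete Boolean algebra $B$ with a contact relation $\rho$ and a subset $\mathbb B\subseteq B$ (the bounded elements) which contains $0$, is closed downwards and under finite joins, and satisfies: if $a\in\mathbb B$ and $a\ll_\rho c$, then $a\ll_\rho b\ll_\rho c$ for some $b\in\mathbb B$; if $a\rho b$, then $a\rho(c\wedge b)$ for some $c\in\mathbb B$; if $a\ne0$, then $b\ll_\rho a$ for some $0\neq b\in\mathbb B$. The category $\mathbf{IOAL}$ has the CLCAs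 as objects; its morphisms $\varphi:(A,\rho,\mathbb B)\to(B,\eta,\mathbb B')$ are the complete Boolean homomorphisms such that (L1) $\varphi(a)\,\eta\,\varphi(b)$ implies $a\rho b$ for all $a,b\in A$; (L2) $b\in\mathbb B'$ implies $\varphi_\Lambda(b)\in\mathbb B$; (IS) for every ultrafilter $u$ of $A$ meeting $\mathbb B$ there is an ultrafilter $v$ of $B$ meeting $\mathbb B'$ with $\varphi_\Lambda(b)\,\rho\,a$ for all $b\in v$, $a\in u$; (LO) for all $a\in A$, $b\in\mathbb B'$: $\varphi_\Lambda(b)\,\rho\,a$ implies $b\,\eta\,\varphi(a)$. \textbf{MVD-algebras.} A complete MVD-algebra $(B,\le,\ll)$ is a complete Boolean algebra with a relation $\ll$ such that: $a\ll b\Rightarrow a\le b$; $0\ll0$; $a\le b\ll c\le t\Rightarrow a\ll t$; $a\ll c$ and $b\ll c$ imply $a\vee b\ll c$; $a\ll c$ implies $a\ll b\ll c$ for some $b$; if $a\ne0$ there is $b\neq0$ with $b\ll a$; $a\ll b$ and $a\ll c$ imply $a\ll b\wedge c$; if $a\ll1$ and $b^*\ll a^*$ then $a\ll b$. The category $\mathbf{IIOAL}$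 has the complete MVD-algebras as objects; its morphisms $\varphi:(A,\le,\ll)\to(B,\le',\ll')$ are the complete Boolean homomorphisms such that (S1) for all $a,b\in A$: if $c\wedge a\ll c^*\vee b$ for all $c\in A$ with $c\ll1$, then $d\wedge\varphi(a)\ll' d^*\vee\varphi(b)$ for all $d\in B$ with $d\ll'1$; (S2) $b\ll'1$ implies $\varphi_\Lambda(b)\ll1$ for all $b\in B$; (IS') for every ultrafilter $u$ of $A$ containing some $c\ll1$ there is an ultrafilter $v$ of $B$ containing some $c'\ll'1$, such that for all $a\in u$ and $b\in v$ there is $c''\in A$ with $c''\ll1$ and not $\varphi_\Lambda(b)\wedge c''\ll(a\wedge c'')^*$; (SO) for all $a\in A$, $b\in B$: $b\ll'\varphi(a)$ implies $\varphi_\Lambda(b)\ll a$. In both categories composition is composition of functions. Let $\mathbf{SOLC}$ be the category of locally compact Hausdorff spaces and surjective continuous open maps. \textbf{Theorem.} The categories $\mathbf{IOAL}$ and $\mathbf{IIOAL}$ are isomorphic: there are functors $K:\mathbf{IOAL}\to\mathbf{IIOAL}$ and $\Theta:\mathbf{IIOAL}\to\mathbf{IOAL}$ with $\Theta\circ K=\mathrm{Id}_{\mathbf{IOAL}}$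 and $K\circ\Theta=\mathrm{Id}_{\mathbf{IIOAL}}$. Hence the categories $\mathbf{SOLC}$ and $\mathbf{IIOAL}$ are dually equivalent. -/

import Mathlib

open CategoryTheory Order

universe u

/-! ### Lower adjoints and ultrafilters -/

/-- The lower adjoint `φ_Λ : B → A` of a complete Boolean homomorphism `φ : A → B`. -/
def lowerAdjoint {A B : Type*} [CompleteBooleanAlgebra A] [CompleteBooleanAlgebra B]
    (φ : CompleteLatticeHom A B) (b : B) : A :=
  sInf {a | b ≤ φ a}

/-- `b ≤ φ a ↔ φ_Λ b ≤ a`; this determines `φ_Λ` uniquely. -/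
theorem lowerAdjoint_gc {A B : Type*} [CompleteBooleanAlgebra A] [CompleteBooleanAlgebra B]
    (φ : CompleteLatticeHom A B) : GaloisConnection (lowerAdjoint φ) φ := by
  intro b a
  constructor
  · intro h
    have h1 : b ≤ φ (lowerAdjoint φ b) := by
      rw [lowerAdjoint, map_sInf]
      refine le_sInf ?_
      rintro _ ⟨x, hx, rfl⟩
      exact hx
    exact h1.trans (OrderHomClass.mono φ h)
  · intro h
    exact sInf_le h

theorem lowerAdjoint_comp {A B C : Type*} [CompleteBooleanAlgebra A] [CompleteBooleanAlgebra B]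
    [CompleteBooleanAlgebra C] (ψ : CompleteLatticeHom B C) (φ : CompleteLatticeHom A B) (c : C) :
    lowerAdjoint (ψ.comp φ) c = lowerAdjoint φ (lowerAdjoint ψ c) :=
  eq_of_forall_ge_iff fun a => by
    rw [lowerAdjoint_gc, lowerAdjoint_gc, lowerAdjoint_gc]
    rfl

theorem lowerAdjoint_id {A : Type*} [CompleteBooleanAlgebra A] (a : A) :
    lowerAdjoint (CompleteLatticeHom.id A) a = a :=
  eq_of_forall_ge_iff fun b => by
    rw [lowerAdjoint_gc]
    rfl

/-- A filter of a Boolean algebra is an ultrafilter if it is proper and contains, for every `a`,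
either `a` or its complement. -/
def IsUltra {B : Type*} [BooleanAlgebra B] (F : PFilter B) : Prop :=
  ⊥ ∉ F ∧ ∀ a : B, a ∈ F ∨ aᶜ ∈ F

/-! ### Local contact algebras -/

/-- `(B, C)` is a contact algebra. -/
structure IsContactAlgebra {B : Type*} [BooleanAlgebra B] (C : B → B → Prop) : Prop where
  c1 : ∀ a, a ≠ ⊥ → C a a
  c2 : ∀ a b, C a b → a ≠ ⊥ ∧ b ≠ ⊥
  c3 : ∀ a b, C a b → C b a
  c4 : ∀ a b c, C a (b ⊔ c) ↔ C a b ∨ C a c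

/-- Non-tangential inclusion: `a ≪_C b` iff `a` is not in contact with the complement of `b`. -/
def NTIncl {B : Type*} [BooleanAlgebra B] (C : B → B → Prop) (a b : B) : Prop :=
  ¬ C a bᶜ

/-- `(B, ρ, 𝔹)` is a local contact algebra, `bd` being the set `𝔹` of bounded elements. -/
structure IsLocalContactAlgebra {B : Type*} [BooleanAlgebra B] (ρ : B → B → Prop)
    (bd : Set B) : Prop extends IsContactAlgebra ρ where
  bb1 : ⊥ ∈ bd
  bb2 : ∀ a b, a ≤ b → b ∈ bd → a ∈ bd
  bb3 : ∀ a b, a ∈ bd → b ∈ bd → a ⊔ b ∈ bd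
  bc1 : ∀ a c, a ∈ bd → NTIncl ρ a c → ∃ b ∈ bd, NTIncl ρ a b ∧ NTIncl ρ b c
  bc2 : ∀ a b, ρ a b → ∃ c ∈ bd, ρ a (c ⊓ b)
  bc3 : ∀ a, a ≠ ⊥ → ∃ b ∈ bd, b ≠ ⊥ ∧ NTIncl ρ b a

/-- Objects of the category `IOAL`: complete local contact algebras. -/
structure IOAL : Type (u + 1) where
  carrier : Type u
  [algebra : CompleteBooleanAlgebra carrier]
  /-- the contact relation -/
  rel : carrier → carrier → Prop
  /-- the set of bounded elements -/
  bounded : Set carrier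
  isLocalContactAlgebra : IsLocalContactAlgebra rel bounded

attribute [instance] IOAL.algebra

/-- The conditions (L1), (L2), (IS) and (LO) on a complete Boolean homomorphism
`φ : (A, ρ, 𝔹) → (B, η, 𝔹')`. -/
structure IsIOALMorphism {A B : Type*} [CompleteBooleanAlgebra A] [CompleteBooleanAlgebra B]
    (ρ : A → A → Prop) (bdA : Set A) (η : B → B → Prop) (bdB : Set B)
    (φ : CompleteLatticeHom A B) : Prop where
  l1 : ∀ a b : A, η (φ a) (φ b) → ρ a b
  l2 : ∀ b : B, b ∈ bdB → lowerAdjoint φ b ∈ bdA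
  /-- Every bounded ultrafilter `u` of `A` admits a bounded ultrafilter `v` of `B` with
  `φ_Λ(v) ρ u`. -/
  is : ∀ u : PFilter A, IsUltra u → (∃ c ∈ u, c ∈ bdA) →
    ∃ v : PFilter B, IsUltra v ∧ (∃ c ∈ v, c ∈ bdB) ∧
      ∀ b ∈ v, ∀ a ∈ u, ρ (lowerAdjoint φ b) a
  lo : ∀ a : A, ∀ b ∈ bdB, ρ (lowerAdjoint φ b) a → η b (φ a)

theorem IsContactAlgebra.mono {B : Type*} [BooleanAlgebra B] {C : B → B → Prop}
    (h : IsContactAlgebra C) {a a' b b' : B} (ha : a ≤ a') (hb : b ≤ b') (hC : C a b) :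
    C a' b' := by
  have h1 : C a b' := by
    rw [← sup_eq_right.2 hb]
    exact (h.c4 _ _ _).2 (Or.inl hC)
  have h2 : C b' a' := by
    rw [← sup_eq_right.2 ha]
    exact (h.c4 _ _ _).2 (Or.inl (h.c3 _ _ h1))
  exact h.c3 _ _ h2

theorem IsIOALMorphism.id {A : Type*} [CompleteBooleanAlgebra A] {ρ : A → A → Prop} {bd : Set A}
    (h : IsLocalContactAlgebra ρ bd) :
    IsIOALMorphism ρ bd ρ bd (CompleteLatticeHom.id A) where
  l1 _ _ h := h
  l2 b hb := by rwa [lowerAdjoint_id]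
  is u hu hb := ⟨u, hu, hb, fun b hbu a hau => by
    rw [lowerAdjoint_id]
    refine h.mono (a := b ⊓ a) (b := b ⊓ a) inf_le_left inf_le_right (h.c1 _ fun h0 => ?_)
    exact hu.1 (h0 ▸ PFilter.inf_mem hbu hau)⟩
  lo a b _ h := by rwa [lowerAdjoint_id] at h

theorem IsIOALMorphism.comp {A B D : Type*} [CompleteBooleanAlgebra A]
    [CompleteBooleanAlgebra B] [CompleteBooleanAlgebra D]
    {ρ : A → A → Prop} {bdA : Set A} {η : B → B → Prop} {bdB : Set B}
    {ζ : D → D → Prop} {bdD : Set D} (hA : IsLocalContactAlgebra ρ bdA)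
    (hB : IsLocalContactAlgebra η bdB) (hD : IsLocalContactAlgebra ζ bdD)
    {ψ : CompleteLatticeHom B D} {φ : CompleteLatticeHom A B}
    (hψ : IsIOALMorphism η bdB ζ bdD ψ) (hφ : IsIOALMorphism ρ bdA η bdB φ) :
    IsIOALMorphism ρ bdA ζ bdD (ψ.comp φ) where
  l1 a b h := hφ.l1 _ _ (hψ.l1 _ _ h)
  l2 b hb := by
    rw [lowerAdjoint_comp]
    exact hφ.l2 _ (hψ.l2 _ hb)
  is u hu hub := by
    obtain ⟨v, hv, hvb, huv⟩ := hφ.is u hu hub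
    obtain ⟨w, hw, ⟨e, hew, heb⟩, hvw⟩ := hψ.is v hv hvb
    refine ⟨w, hw, ⟨e, hew, heb⟩, fun d hd a ha => ?_⟩
    rw [lowerAdjoint_comp]
    have hdw : d ⊓ e ∈ w := PFilter.inf_mem hd hew
    have hdb : d ⊓ e ∈ bdD := hD.bb2 _ _ inf_le_right heb
    set p := lowerAdjoint φ (lowerAdjoint ψ (d ⊓ e)) with hp
    have hpb : p ∈ bdA := hφ.l2 _ (hψ.l2 _ hdb)
    have hpd : p ≤ lowerAdjoint φ (lowerAdjoint ψ d) :=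
      (lowerAdjoint_gc φ).monotone_l ((lowerAdjoint_gc ψ).monotone_l inf_le_left)
    refine hA.mono hpd le_rfl ?_
    by_contra hpa
    obtain ⟨q, -, hpq, hqa⟩ := hA.bc1 p aᶜ hpb (by rwa [NTIncl, compl_compl])
    rw [NTIncl, compl_compl] at hqa
    rcases hv.2 (φ q) with h | h
    · exact hqa (hA.mono ((lowerAdjoint_gc φ).l_u_le q) le_rfl (huv _ h a ha))
    · have h1 := hvw _ hdw _ h
      rw [← map_compl'] at h1
      exact hpq (hφ.l1 _ _ (hB.mono ((lowerAdjoint_gc φ).le_u_l _) le_rfl h1))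
  lo a b hb h := by
    rw [lowerAdjoint_comp] at h
    exact hψ.lo _ _ hb (hφ.lo _ _ (hψ.l2 _ hb) h)

/-- Morphisms of `IOAL`. -/
@[ext]
structure IOAL.Hom (X Y : IOAL.{u}) : Type u where
  toHom : CompleteLatticeHom X.carrier Y.carrier
  prop : IsIOALMorphism X.rel X.bounded Y.rel Y.bounded toHom

instance : Category.{u} IOAL.{u} where
  Hom := IOAL.Hom
  id X := ⟨CompleteLatticeHom.id X.carrier, .id X.isLocalContactAlgebra⟩
  comp {X Y Z} f g := ⟨g.toHom.comp f.toHom, .comp X.isLocalContactAlgebra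
    Y.isLocalContactAlgebra Z.isLocalContactAlgebra g.prop f.prop⟩

/-! ### MVD-algebras -/

/-- `(B, ≤, ≪)` is an MVD-algebra. -/
structure IsMVDAlgebra {B : Type*} [BooleanAlgebra B] (ll : B → B → Prop) : Prop where
  ll1 : ∀ a b, ll a b → a ≤ b
  ll2 : ll ⊥ ⊥
  ll3 : ∀ a b c t, a ≤ b → ll b c → c ≤ t → ll a t
  ll4 : ∀ a b c, ll a c → ll b c → ll (a ⊔ b) c
  ll5 : ∀ a c, ll a c → ∃ b, ll a b ∧ ll b c
  ll6 : ∀ a, a ≠ ⊥ → ∃ b, b ≠ ⊥ ∧ ll b a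
  ll4' : ∀ a b c, ll a b → ll a c → ll a (b ⊓ c)
  mvd : ∀ a b, ll a ⊤ → ll bᶜ aᶜ → ll a b

/-- Objects of the category `IIOAL`: complete MVD-algebras. -/
structure IIOAL : Type (u + 1) where
  carrier : Type u
  [algebra : CompleteBooleanAlgebra carrier]
  /-- the relation `≪` -/
  ll : carrier → carrier → Prop
  isMVDAlgebra : IsMVDAlgebra ll

attribute [instance] IIOAL.algebra

/-- The conditions (S1), (S2), (IS') and (SO) on a complete Boolean homomorphism
`φ : (A, ≤, ≪) → (B, ≤', ≪')`. -/
structure IsIIOALMorphism {A B : Type*} [CompleteBooleanAlgebra A] [CompleteBooleanAlgebra B]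
    (llA : A → A → Prop) (llB : B → B → Prop) (φ : CompleteLatticeHom A B) : Prop where
  s1 : ∀ a b : A, (∀ c, llA c ⊤ → llA (c ⊓ a) (cᶜ ⊔ b)) →
    ∀ d, llB d ⊤ → llB (d ⊓ φ a) (dᶜ ⊔ φ b)
  s2 : ∀ b : B, llB b ⊤ → llA (lowerAdjoint φ b) ⊤
  is' : ∀ u : PFilter A, IsUltra u → (∃ c ∈ u, llA c ⊤) →
    ∃ v : PFilter B, IsUltra v ∧ (∃ c' ∈ v, llB c' ⊤) ∧
      ∀ a ∈ u, ∀ b ∈ v, ∃ c'' : A, llA c'' ⊤ ∧ ¬ llA (lowerAdjoint φ b ⊓ c'') (a ⊓ c'')ᶜ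
  so : ∀ (a : A) (b : B), llB b (φ a) → llA (lowerAdjoint φ b) a

theorem IsIIOALMorphism.id {A : Type*} [CompleteBooleanAlgebra A] {ll : A → A → Prop}
    (h : IsMVDAlgebra ll) : IsIIOALMorphism ll ll (CompleteLatticeHom.id A) where
  s1 _ _ h := h
  s2 b hb := by rwa [lowerAdjoint_id]
  is' u hu hb := ⟨u, hu, hb, fun a ha b hbu => by
    obtain ⟨c, hc, hcb⟩ := hb
    refine ⟨c, hcb, fun h1 => hu.1 ?_⟩
    rw [lowerAdjoint_id] at h1
    have h2 : (b ⊓ c) ⊓ (a ⊓ c) ≤ ⊥ :=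
      (le_compl_iff_disjoint_right.1 (h.ll1 _ _ h1)).le_bot
    exact PFilter.mem_of_le h2
      (PFilter.inf_mem (PFilter.inf_mem hbu hc) (PFilter.inf_mem ha hc))⟩
  so a b h := by rwa [lowerAdjoint_id]

theorem IsIIOALMorphism.comp {A B D : Type*} [CompleteBooleanAlgebra A]
    [CompleteBooleanAlgebra B] [CompleteBooleanAlgebra D]
    {llA : A → A → Prop} {llB : B → B → Prop} {llD : D → D → Prop} (hA : IsMVDAlgebra llA)
    (hB : IsMVDAlgebra llB) (hD : IsMVDAlgebra llD)
    {ψ : CompleteLatticeHom B D} {φ : CompleteLatticeHom A B}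
    (hψ : IsIIOALMorphism llB llD ψ) (hφ : IsIIOALMorphism llA llB φ) :
    IsIIOALMorphism llA llD (ψ.comp φ) where
  s1 a b h := hψ.s1 _ _ (hφ.s1 _ _ h)
  s2 b hb := by
    rw [lowerAdjoint_comp]
    exact hφ.s2 _ (hψ.s2 _ hb)
  is' u hu hub := by
    obtain ⟨v, hv, hvb, huv⟩ := hφ.is' u hu hub
    obtain ⟨w, hw, ⟨e, hew, heb⟩, hvw⟩ := hψ.is' v hv hvb
    refine ⟨w, hw, ⟨e, hew, heb⟩, fun a ha d hd => ?_⟩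
    rw [lowerAdjoint_comp]
    have hdw : d ⊓ e ∈ w := PFilter.inf_mem hd hew
    have hdb : llD (d ⊓ e) ⊤ := hD.ll3 _ _ _ _ inf_le_right heb le_rfl
    set p := lowerAdjoint φ (lowerAdjoint ψ (d ⊓ e)) with hp
    have hpb : llA p ⊤ := hφ.s2 _ (hψ.s2 _ hdb)
    have hpd : p ≤ lowerAdjoint φ (lowerAdjoint ψ d) :=
      (lowerAdjoint_gc φ).monotone_l ((lowerAdjoint_gc ψ).monotone_l inf_le_left)
    by_contra hcon
    push Not at hcon
    obtain ⟨r, hpr, hr⟩ := hA.ll5 _ _ hpb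
    have hpa : llA p aᶜ := by
      have h1 : llA p (a ⊓ r)ᶜ :=
        hA.ll3 _ _ _ _ (le_inf hpd (hA.ll1 _ _ hpr)) (hcon r hr) le_rfl
      refine hA.ll3 _ _ _ _ le_rfl (hA.ll4' _ _ _ h1 hpr) ?_
      rw [compl_inf, inf_sup_right]
      simp
    obtain ⟨q, hpq, hqa⟩ := hA.ll5 _ _ hpa
    rcases hv.2 (φ q) with h | h
    · obtain ⟨c, -, hc⟩ := huv a ha _ h
      exact hc (hA.ll3 _ _ _ _ (inf_le_left.trans ((lowerAdjoint_gc φ).l_u_le q)) hqa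
        (compl_le_compl inf_le_left))
    · obtain ⟨c, hcb, hc⟩ := hvw _ h _ hdw
      have h1 := hφ.s1 p q (fun x _ => hA.ll3 _ _ _ _ inf_le_right hpq le_sup_right) c hcb
      refine hc (hB.ll3 _ _ _ _ (le_inf inf_le_right
        (inf_le_left.trans ((lowerAdjoint_gc φ).le_u_l _))) h1 ?_)
      rw [compl_inf, compl_compl, sup_comm]
  so a b h := by
    rw [lowerAdjoint_comp]
    exact hφ.so _ _ (hψ.so _ _ h)

/-- Morphisms of `IIOAL`. -/
@[ext]
structure IIOAL.Hom (X Y : IIOAL.{u}) : Type u where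
  toHom : CompleteLatticeHom X.carrier Y.carrier
  prop : IsIIOALMorphism X.ll Y.ll toHom

instance : Category.{u} IIOAL.{u} where
  Hom := IIOAL.Hom
  id X := ⟨CompleteLatticeHom.id X.carrier, .id X.isMVDAlgebra⟩
  comp {X Y Z} f g := ⟨g.toHom.comp f.toHom,
    .comp X.isMVDAlgebra Y.isMVDAlgebra Z.isMVDAlgebra g.prop f.prop⟩

/-! ### Locally compact Hausdorff spaces and surjective open maps -/

/-- Objects of the category `SOLC`: locally compact Hausdorff spaces. -/
structure SOLC : Type (u + 1) where
  carrier : Type u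
  [top : TopologicalSpace carrier]
  [t2 : T2Space carrier]
  [locallyCompact : LocallyCompactSpace carrier]

attribute [instance] SOLC.top SOLC.t2 SOLC.locallyCompact

/-- Morphisms of `SOLC`: continuous open surjections. -/
@[ext]
structure SOLC.Hom (X Y : SOLC.{u}) : Type u where
  toMap : C(X.carrier, Y.carrier)
  isOpenMap : IsOpenMap toMap
  surjective : Function.Surjective toMap

instance : Category.{u} SOLC.{u} where
  Hom := SOLC.Hom
  id X := ⟨ContinuousMap.id X.carrier, IsOpenMap.id, Function.surjective_id⟩
  comp f g := ⟨g.toMap.comp f.toMap, g.isOpenMap.comp f.isOpenMap, g.surjective.comp f.surjective⟩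

/-! ### The isomorphism between `IOAL` and `IIOAL` -/

/-! The two kinds of algebra carry the same data. From `(ρ, 𝔹)` one forms "`a` is bounded and `a ≪_ρ
b`"; then `𝔹` returns as `{a | a ≪ 1}`, and `ρ` returns because contact is always witnessed inside a
bounded element. From `≪` one forms contact inside some `c ≪ 1`; on bounded elements its
non-tangential inclusion is again `≪` (`not_localContact_iff`). Under this dictionary the two lists
of morphism conditions agree for the same `φ` (`isIIOALMorphism_iff`), so both functors fix the
underlying homomorphisms and are mutually inverse on the nose.

The duality is proved directly for `IIOAL`. A space goes to its regular open sets, with `a ≪ b` when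
the closure of `a` is compact and contained in `b`; a map goes to its preimage homomorphism, which
makes sense because preimage under an open map commutes with closure and interior.

Fullness: given `ψ`, the point `f x` is a common point of the closures of `ψ_Λ V` for `V ∋ x`, which
exists by (S2) and compactness. (SO) and (S1) give `x ∈ ψ U ↔ f x ∈ U`, compactness makes `f` open,
and (IS') makes it onto. Essential surjectivity: the points of the dual space are the round filters
of `IsRoundPrime`. Its basic sets are exactly its regular open sets by completeness (`orderIso`),
and compactness of closures translates back into `≪` (`ll_iff`). -/

/-- The relation `a ≪ b` of a local contact algebra: `a` is bounded and `a ≪_ρ b`. -/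
def boundedNTIncl {B : Type*} [BooleanAlgebra B] (ρ : B → B → Prop) (bd : Set B) (a b : B) : Prop :=
  a ∈ bd ∧ NTIncl ρ a b

/-- The contact relation of an MVD-algebra. -/
def localContact {B : Type*} [BooleanAlgebra B] (ll : B → B → Prop) (a b : B) : Prop :=
  ∃ c, ll c ⊤ ∧ ¬ ll (a ⊓ c) (b ⊓ c)ᶜ

/-! ### Translating the axioms of local contact algebras and of MVD-algebras into each other. -/

section Algebra

variable {B : Type*} [BooleanAlgebra B] {ρ ll : B → B → Prop} {bd : Set B}

theorem IsContactAlgebra.ntIncl_top (h : IsContactAlgebra ρ) (a : B) : NTIncl ρ a ⊤ := by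
  intro h1
  rw [compl_top] at h1
  exact (h.c2 _ _ h1).2 rfl

theorem IsContactAlgebra.ntIncl_le (h : IsContactAlgebra ρ) {a b : B} (hab : NTIncl ρ a b) :
    a ≤ b := by
  by_contra h1
  have h2 : a ⊓ bᶜ ≠ ⊥ := fun h2 => h1 (by
    simpa using (disjoint_iff.2 h2).le_compl_right)
  exact hab (h.mono inf_le_left inf_le_right (h.c1 _ h2))

theorem IsLocalContactAlgebra.boundedNTIncl_top (h : IsLocalContactAlgebra ρ bd) (a : B) :
    boundedNTIncl ρ bd a ⊤ ↔ a ∈ bd :=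
  ⟨fun h1 => h1.1, fun h1 => ⟨h1, h.ntIncl_top a⟩⟩

theorem IsLocalContactAlgebra.isMVDAlgebra (h : IsLocalContactAlgebra ρ bd) :
    IsMVDAlgebra (boundedNTIncl ρ bd) where
  ll1 a b hab := h.ntIncl_le hab.2
  ll2 := ⟨h.bb1, fun h1 => (h.c2 _ _ h1).1 rfl⟩
  ll3 a b c t hab hbc hct :=
    ⟨h.bb2 _ _ hab hbc.1, fun h1 => hbc.2 (h.mono hab (compl_le_compl hct) h1)⟩
  ll4 a b c hac hbc := ⟨h.bb3 _ _ hac.1 hbc.1, fun h1 => by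
    rcases (h.c4 _ _ _).1 (h.c3 _ _ h1) with h2 | h2
    · exact hac.2 (h.c3 _ _ h2)
    · exact hbc.2 (h.c3 _ _ h2)⟩
  ll5 a c hac := by
    obtain ⟨b, hb, h1, h2⟩ := h.bc1 a c hac.1 hac.2
    exact ⟨b, ⟨hac.1, h1⟩, hb, h2⟩
  ll6 a ha := by
    obtain ⟨b, hb, h1, h2⟩ := h.bc3 a ha
    exact ⟨b, h1, hb, h2⟩
  ll4' a b c hab hac := ⟨hab.1, fun h1 => by
    rw [compl_inf] at h1
    rcases (h.c4 _ _ _).1 h1 with h2 | h2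
    · exact hab.2 h2
    · exact hac.2 h2⟩
  mvd a b ha hab := ⟨ha.1, fun h1 => hab.2 (by
    rw [compl_compl]
    exact h.c3 _ _ h1)⟩

theorem IsMVDAlgebra.ll_compl_comm (h : IsMVDAlgebra ll) {a b : B} (hb : ll b ⊤)
    (hab : ll a bᶜ) : ll b aᶜ :=
  h.mvd _ _ hb (by rwa [compl_compl])

/-- On bounded elements the derived contact relation loses nothing: a single test element `c` with
`a ≪ c ≪ 1` decides the question, since `a ⊓ c = a` and `(bᶜ ⊓ c)ᶜ ⊓ c ≤ b`. -/
theorem IsMVDAlgebra.not_localContact_iff (h : IsMVDAlgebra ll) {a b : B} (ha : ll a ⊤) :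
    ¬ localContact ll a bᶜ ↔ ll a b := by
  constructor
  · intro h1
    obtain ⟨c, hac, hc⟩ := h.ll5 _ _ ha
    by_contra h2
    refine h1 ⟨c, hc, fun h3 => h2 ?_⟩
    have h4 : ll a (bᶜ ⊓ c)ᶜ := h.ll3 _ _ _ _ (le_inf le_rfl (h.ll1 _ _ hac)) h3 le_rfl
    refine h.ll3 _ _ _ _ le_rfl (h.ll4' _ _ _ h4 hac) ?_
    rw [compl_inf, compl_compl, inf_sup_right]
    simp
  · rintro h1 ⟨c, -, hc⟩
    refine hc (h.ll3 _ _ _ _ inf_le_left h1 ?_)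
    rw [compl_inf, compl_compl]
    exact le_sup_left

/-- Both the premise and the conclusion of (S1) are instances of the left side, so (S1) is the
contrapositive of (L1). -/
theorem forall_ll_iff_not_localContact (a b : B) :
    (∀ c, ll c ⊤ → ll (c ⊓ a) (cᶜ ⊔ b)) ↔ ¬ localContact ll a bᶜ := by
  simp only [localContact, not_exists, not_and, not_not, compl_inf, compl_compl]
  refine forall₂_congr fun c _ => ?_
  rw [inf_comm, sup_comm]

theorem IsMVDAlgebra.localContact_symm (h : IsMVDAlgebra ll) {a b : B}
    (hab : localContact ll a b) : localContact ll b a := by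
  obtain ⟨c, hc, hc'⟩ := hab
  exact ⟨c, hc, fun h1 => hc' (h.ll_compl_comm (h.ll3 _ _ _ _ inf_le_right hc le_rfl) h1)⟩

theorem IsMVDAlgebra.isLocalContactAlgebra (h : IsMVDAlgebra ll) :
    IsLocalContactAlgebra (localContact ll) {a | ll a ⊤} where
  c1 a ha := by
    obtain ⟨b, hb, hba⟩ := h.ll6 a ha
    refine ⟨b, h.ll3 _ _ _ _ le_rfl hba le_top, fun h1 => hb ?_⟩
    have h2 := h.ll1 _ _ h1
    rw [inf_eq_right.2 (h.ll1 _ _ hba)] at h2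
    simpa using le_compl_self.1 h2
  c2 a b := by
    rintro ⟨c, hc, h1⟩
    constructor <;> rintro rfl <;> apply h1
    · exact h.ll3 _ _ _ _ inf_le_left h.ll2 bot_le
    · exact h.ll3 _ _ _ _ inf_le_right hc (by simp)
  c3 a b := h.localContact_symm
  c4 a b c := by
    constructor
    · rintro ⟨d, hd, h1⟩
      by_contra h2
      simp only [localContact, not_or, not_exists, not_and, not_not] at h2
      refine h1 (h.ll3 _ _ _ _ le_rfl (h.ll4' _ _ _ (h2.1 d hd) (h2.2 d hd)) ?_)
      rw [← compl_sup, inf_sup_right]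
    · rintro (⟨d, hd, h1⟩ | ⟨d, hd, h1⟩)
      · exact ⟨d, hd, fun h2 => h1 (h.ll3 _ _ _ _ le_rfl h2
          (compl_le_compl (inf_le_inf_right _ le_sup_left)))⟩
      · exact ⟨d, hd, fun h2 => h1 (h.ll3 _ _ _ _ le_rfl h2
          (compl_le_compl (inf_le_inf_right _ le_sup_right)))⟩
  bb1 := h.ll3 _ _ _ _ le_rfl h.ll2 le_top
  bb2 a b hab hb := h.ll3 _ _ _ _ hab hb le_rfl
  bb3 a b ha hb := h.ll4 _ _ _ ha hb
  bc1 a c ha hac := by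
    obtain ⟨b, hab, hbc⟩ := h.ll5 _ _ ((h.not_localContact_iff ha).1 hac)
    have hb : ll b ⊤ := h.ll3 _ _ _ _ le_rfl hbc le_top
    exact ⟨b, hb, (h.not_localContact_iff ha).2 hab, (h.not_localContact_iff hb).2 hbc⟩
  bc2 a b := by
    rintro ⟨c, hc, h1⟩
    -- The element witnessing contact also serves as the bounded part of `b`.
    refine ⟨c, hc, c, hc, ?_⟩
    rwa [inf_comm c b, inf_assoc, inf_idem]
  bc3 a ha := by
    obtain ⟨b, hb, hba⟩ := h.ll6 a ha
    have hb' : ll b ⊤ := h.ll3 _ _ _ _ le_rfl hba le_top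
    exact ⟨b, hb', hb, (h.not_localContact_iff hb').2 hba⟩

theorem IsMVDAlgebra.boundedNTIncl_localContact (h : IsMVDAlgebra ll) :
    boundedNTIncl (localContact ll) {a | ll a ⊤} = ll := by
  ext a b
  constructor
  · rintro ⟨ha, hab⟩
    exact (h.not_localContact_iff ha).1 hab
  · intro hab
    have ha : ll a ⊤ := h.ll3 _ _ _ _ le_rfl hab le_top
    exact ⟨ha, (h.not_localContact_iff ha).2 hab⟩

theorem IsLocalContactAlgebra.localContact_boundedNTIncl (h : IsLocalContactAlgebra ρ bd) :
    localContact (boundedNTIncl ρ bd) = ρ := by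
  ext a b
  constructor
  · rintro ⟨c, hc, h1⟩
    by_contra h2
    refine h1 ⟨h.bb2 _ _ inf_le_right hc.1, fun h3 => h2 ?_⟩
    rw [compl_compl] at h3
    exact h.mono inf_le_left inf_le_left h3
  · intro hab
    obtain ⟨c, hc, h1⟩ := h.bc2 _ _ hab
    obtain ⟨d, hd, h2⟩ := h.bc2 _ _ (h.c3 _ _ h1)
    -- Bounding each side of `a ρ b` in turn gives `c` and `d`; their join bounds both sides at
    -- once.
    refine ⟨c ⊔ d, (h.boundedNTIncl_top _).2 (h.bb3 _ _ hc hd), fun h3 => h3.2 ?_⟩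
    rw [compl_compl]
    refine h.mono ?_ ?_ (h.c3 _ _ h2)
    · exact le_inf inf_le_right (inf_le_left.trans le_sup_right)
    · exact le_inf inf_le_right (inf_le_left.trans le_sup_left)

theorem IsLocalContactAlgebra.setOf_boundedNTIncl_top (h : IsLocalContactAlgebra ρ bd) :
    {a | boundedNTIncl ρ bd a ⊤} = bd :=
  Set.ext h.boundedNTIncl_top

end Algebra

/-- (S2) and (IS') are (L2) and (IS) up to the order of quantifiers, while (S1) and (SO) are the
contrapositives of (L1) and (LO). For the last pair, `b` and `φ_Λ b` are bounded, so
`not_localContact_iff` applies to both. -/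
theorem isIIOALMorphism_iff {A B : Type*} [CompleteBooleanAlgebra A] [CompleteBooleanAlgebra B]
    {llA : A → A → Prop} {llB : B → B → Prop} (hA : IsMVDAlgebra llA) (hB : IsMVDAlgebra llB)
    (φ : CompleteLatticeHom A B) :
    IsIIOALMorphism llA llB φ ↔
      IsIOALMorphism (localContact llA) {a | llA a ⊤} (localContact llB) {b | llB b ⊤} φ := by
  constructor
  · intro h
    refine ⟨fun a b hab => ?_, h.s2, fun u hu hub => ?_, fun a b hb hab => ?_⟩
    · by_contra h1
      have h2 := h.s1 a bᶜ ((forall_ll_iff_not_localContact _ _).2 (by rwa [compl_compl]))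
      rw [forall_ll_iff_not_localContact, map_compl', compl_compl] at h2
      exact h2 hab
    · obtain ⟨v, hv, hvb, huv⟩ := h.is' u hu hub
      exact ⟨v, hv, hvb, fun b hb a ha => huv a ha b hb⟩
    · by_contra h1
      rw [← compl_compl (φ a), hB.not_localContact_iff hb, ← map_compl'] at h1
      exact (hA.not_localContact_iff (h.s2 _ hb)).2 (h.so _ _ h1) (by rwa [compl_compl])
  · intro h
    refine ⟨fun a b hab => ?_, h.l2, fun u hu hub => ?_, fun a b hab => ?_⟩
    · rw [forall_ll_iff_not_localContact] at hab
      rw [forall_ll_iff_not_localContact, ← map_compl']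
      exact fun h1 => hab (h.l1 _ _ h1)
    · obtain ⟨v, hv, hvb, huv⟩ := h.is u hu hub
      exact ⟨v, hv, hvb, fun a ha b hb => huv b hb a ha⟩
    · have hb : llB b ⊤ := hB.ll3 _ _ _ _ le_rfl hab le_top
      rw [← hA.not_localContact_iff (h.l2 _ hb)]
      intro h1
      have h2 := h.lo _ _ hb h1
      rw [map_compl'] at h2
      exact (hB.not_localContact_iff hb).2 hab h2

/-- The functor sending `(B, ρ, 𝔹)` to the complete MVD-algebra `(B, ≤, ≪)`. -/
def IOAL.toIIOAL : IOAL.{u} ⥤ IIOAL.{u} where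
  obj X := ⟨X.carrier, boundedNTIncl X.rel X.bounded, X.isLocalContactAlgebra.isMVDAlgebra⟩
  map {X Y} f := ⟨f.toHom, by
    have h := f.prop
    rw [isIIOALMorphism_iff X.isLocalContactAlgebra.isMVDAlgebra
      Y.isLocalContactAlgebra.isMVDAlgebra]
    -- The criterion speaks of the contact algebra rebuilt from `≪`; the round trip identifies it
    -- with the given one.
    rwa [X.isLocalContactAlgebra.localContact_boundedNTIncl,
      Y.isLocalContactAlgebra.localContact_boundedNTIncl,
      X.isLocalContactAlgebra.setOf_boundedNTIncl_top,
      Y.isLocalContactAlgebra.setOf_boundedNTIncl_top]⟩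

/-- The functor sending `(B, ≤, ≪)` to the complete local contact algebra `(B, ρ, 𝔹)`. -/
def IIOAL.toIOAL : IIOAL.{u} ⥤ IOAL.{u} where
  obj X := ⟨X.carrier, localContact X.ll, {a | X.ll a ⊤}, X.isMVDAlgebra.isLocalContactAlgebra⟩
  map {X Y} f := ⟨f.toHom, (isIIOALMorphism_iff X.isMVDAlgebra Y.isMVDAlgebra _).1 f.prop⟩

theorem IOAL.toIIOAL_comp_toIOAL : IOAL.toIIOAL.{u} ⋙ IIOAL.toIOAL = 𝟭 IOAL := by
  refine Functor.hext (fun X => ?_) (fun X Y f => ?_)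
  · obtain ⟨B, ρ, bd, h⟩ := X
    simp only [Functor.comp_obj, IOAL.toIIOAL, IIOAL.toIOAL, Functor.id_obj]
    congr 1
    · exact h.localContact_boundedNTIncl
    · exact h.setOf_boundedNTIncl_top
  -- The two morphisms share their homomorphism but live over objects that are only propositionally
  -- equal; with the relations as variables, these equalities can be substituted.
  · have key : ∀ {A B : Type u} [CompleteBooleanAlgebra A] [CompleteBooleanAlgebra B]
        (ρ ρ' : A → A → Prop) (bA bA' : Set A) (η η' : B → B → Prop) (bB bB' : Set B)
        (h₁ : IsLocalContactAlgebra ρ bA) (h₁' : IsLocalContactAlgebra ρ' bA')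
        (h₂ : IsLocalContactAlgebra η bB) (h₂' : IsLocalContactAlgebra η' bB')
        (φ : CompleteLatticeHom A B) (h : IsIOALMorphism ρ bA η bB φ)
        (h' : IsIOALMorphism ρ' bA' η' bB' φ), ρ = ρ' → bA = bA' → η = η' → bB = bB' →
        HEq (⟨φ, h⟩ : IOAL.Hom ⟨A, ρ, bA, h₁⟩ ⟨B, η, bB, h₂⟩)
          (⟨φ, h'⟩ : IOAL.Hom ⟨A, ρ', bA', h₁'⟩ ⟨B, η', bB', h₂'⟩) := by
      rintro A B _ _ ρ _ bA _ η _ bB _ h₁ h₁' h₂ h₂' φ h h' rfl rfl rfl rfl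
      rfl
    exact key _ _ _ _ _ _ _ _ _ X.isLocalContactAlgebra _ Y.isLocalContactAlgebra f.toHom _ f.prop
      X.isLocalContactAlgebra.localContact_boundedNTIncl
      X.isLocalContactAlgebra.setOf_boundedNTIncl_top
      Y.isLocalContactAlgebra.localContact_boundedNTIncl
      Y.isLocalContactAlgebra.setOf_boundedNTIncl_top

theorem IIOAL.toIOAL_comp_toIIOAL : IIOAL.toIOAL.{u} ⋙ IOAL.toIIOAL = 𝟭 IIOAL := by
  refine Functor.hext (fun X => ?_) (fun X Y f => ?_)
  · obtain ⟨B, ll, h⟩ := X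
    simp only [Functor.comp_obj, IOAL.toIIOAL, IIOAL.toIOAL, Functor.id_obj]
    congr 1
    exact h.boundedNTIncl_localContact
  · have key : ∀ {A B : Type u} [CompleteBooleanAlgebra A] [CompleteBooleanAlgebra B]
        (r r' : A → A → Prop) (s s' : B → B → Prop)
        (h₁ : IsMVDAlgebra r) (h₁' : IsMVDAlgebra r')
        (h₂ : IsMVDAlgebra s) (h₂' : IsMVDAlgebra s')
        (φ : CompleteLatticeHom A B) (h : IsIIOALMorphism r s φ)
        (h' : IsIIOALMorphism r' s' φ), r = r' → s = s' →
        HEq (⟨φ, h⟩ : IIOAL.Hom ⟨A, r, h₁⟩ ⟨B, s, h₂⟩)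
          (⟨φ, h'⟩ : IIOAL.Hom ⟨A, r', h₁'⟩ ⟨B, s', h₂'⟩) := by
      rintro A B _ _ r _ s _ h₁ h₁' h₂ h₂' φ h h' rfl rfl
      rfl
    exact key _ _ _ _ _ X.isMVDAlgebra _ Y.isMVDAlgebra f.toHom _ f.prop
      X.isMVDAlgebra.boundedNTIncl_localContact Y.isMVDAlgebra.boundedNTIncl_localContact

/-! ### Ultrafilters of a Boolean algebra -/

/-- Separate the filter from the zero ideal by a prime ideal and take its complement. -/
theorem exists_isUltra_ge {B : Type*} [BooleanAlgebra B] (F : PFilter B) (hF : ⊥ ∉ F) :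
    ∃ u : PFilter B, IsUltra u ∧ ∀ a ∈ F, a ∈ u := by
  have hd : Disjoint (F : Set B) ((Ideal.principal ⊥ : Ideal B) : Set B) := by
    rw [Set.disjoint_left]
    intro a ha h1
    have h2 : a ≤ ⊥ := h1
    exact hF (PFilter.mem_of_le h2 ha)
  obtain ⟨J, hJ, -, hFJ⟩ := DistribLattice.prime_ideal_of_disjoint_filter_ideal hd
  have hmem : ∀ a, a ∈ hJ.compl_filter.toPFilter ↔ a ∉ J := fun a => Iff.rfl
  refine ⟨hJ.compl_filter.toPFilter, ⟨fun h => (hmem _).1 h J.bot_mem, fun a => ?_⟩, fun a ha => ?_⟩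
  · rw [hmem, hmem]
    by_contra! h
    have h1 : a ⊔ aᶜ ∈ J := Ideal.sup_mem h.1 h.2
    rw [sup_compl_eq_top] at h1
    exact hJ.ne_top (Ideal.top_of_top_mem h1)
  · exact (hmem _).2 fun h => Set.disjoint_left.1 hFJ ha h

/-! ### The complete Boolean algebra of regular open sets -/

open TopologicalSpace

/-- The regular open subsets of a topological space. -/
def RegOpens (X : Type*) [TopologicalSpace X] : Type _ := Heyting.Regular (Opens X)

namespace RegOpens

section Basic

variable {X : Type*} [TopologicalSpace X]

/-- The underlying open set. -/
def toOpens (a : RegOpens X) : Opens X := Heyting.Regular.val a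

theorem toOpens_injective : Function.Injective (toOpens (X := X)) := Heyting.Regular.coe_injective

instance : SetLike (RegOpens X) X where
  coe a := (toOpens a : Set X)
  coe_injective _ _ h := toOpens_injective (SetLike.coe_injective h)

theorem isOpen (a : RegOpens X) : IsOpen (a : Set X) := (toOpens a).isOpen

theorem interior_closure (a : RegOpens X) : interior (closure (a : Set X)) = a := by
  have h := congrArg (SetLike.coe : Opens X → Set X) (Heyting.Regular.prop a).eq
  rwa [Opens.coe_compl_eq_interior_compl, Opens.coe_compl_eq_interior_compl,
    _root_.interior_compl, _root_.interior_compl, closure_compl, _root_.compl_compl] at h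

/-- A regular open set given by its carrier. -/
def mk (s : Set X) (hs : interior (closure s) = s) : RegOpens X :=
  show Heyting.Regular (Opens X) from ⟨⟨s, hs ▸ isOpen_interior⟩, by
    refine SetLike.coe_injective ?_
    rw [Opens.coe_compl_eq_interior_compl, Opens.coe_compl_eq_interior_compl,
      _root_.interior_compl, _root_.interior_compl, closure_compl, _root_.compl_compl]
    exact hs⟩

/-- The interior of the closure of a set, as a regular open set. -/
def ofSet (s : Set X) : RegOpens X := mk (interior (closure s)) interior_closure_idem

theorem subset_ofSet {s : Set X} (hs : IsOpen s) : s ⊆ ofSet s :=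
  interior_maximal subset_closure hs

theorem ofSet_subset_iff {s : Set X} (hs : IsOpen s) {a : RegOpens X} :
    (ofSet s : Set X) ⊆ a ↔ s ⊆ a := by
  refine ⟨fun h => (subset_ofSet hs).trans h, fun h => ?_⟩
  rw [← interior_closure a]
  exact interior_mono (closure_mono h)

noncomputable instance : CompleteBooleanAlgebra (RegOpens X) where
  __ := (inferInstance : BooleanAlgebra (Heyting.Regular (Opens X)))
  sSup s := ofSet (⋃ a ∈ s, (a : Set X))
  -- The meet is taken as the join of all lower bounds, so the universal property of `ofSet` handles
  -- both cases.
  sInf s := ofSet (⋃ b ∈ {b : RegOpens X | ∀ a ∈ s, (b : Set X) ⊆ a}, (b : Set X))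
  isLUB_sSup s := by
    have ho : IsOpen (⋃ a ∈ s, (a : Set X)) := isOpen_biUnion fun a _ => a.isOpen
    constructor
    · intro a ha
      exact (Set.subset_biUnion_of_mem (u := fun a : RegOpens X => (a : Set X)) ha).trans
        (subset_ofSet ho)
    · intro b hb
      exact (ofSet_subset_iff ho).2 (Set.iUnion₂_subset hb)
  isGLB_sInf s := by
    have ho : IsOpen (⋃ b ∈ {b : RegOpens X | ∀ a ∈ s, (b : Set X) ⊆ a}, (b : Set X)) :=
      isOpen_biUnion fun a _ => a.isOpen
    constructor
    · intro a ha
      exact (ofSet_subset_iff ho).2 (Set.iUnion₂_subset fun b hb => hb a ha)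
    · intro b hb
      exact (Set.subset_biUnion_of_mem (u := fun a : RegOpens X => (a : Set X))
        (show b ∈ {b : RegOpens X | ∀ a ∈ s, (b : Set X) ⊆ a} from hb)).trans (subset_ofSet ho)

theorem le_iff {a b : RegOpens X} : a ≤ b ↔ (a : Set X) ⊆ b := Iff.rfl

theorem ofSet_le_iff {s : Set X} (hs : IsOpen s) {a : RegOpens X} : ofSet s ≤ a ↔ s ⊆ a :=
  ofSet_subset_iff hs

theorem mem_inf {a b : RegOpens X} {x : X} : x ∈ a ⊓ b ↔ x ∈ a ∧ x ∈ b := Iff.rfl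

theorem coe_compl (a : RegOpens X) : ((aᶜ : RegOpens X) : Set X) = (closure (a : Set X))ᶜ := by
  rw [← interior_compl]
  exact Opens.coe_compl_eq_interior_compl (U := toOpens a)

theorem mem_compl {a : RegOpens X} {x : X} : x ∈ aᶜ ↔ x ∉ closure (a : Set X) := by
  rw [← SetLike.mem_coe, coe_compl, Set.mem_compl_iff]

theorem mem_top (x : X) : x ∈ (⊤ : RegOpens X) := trivial

theorem notMem_bot (x : X) : x ∉ (⊥ : RegOpens X) := fun h => h

theorem closure_coe_bot : closure ((⊥ : RegOpens X) : Set X) = ∅ := closure_empty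

theorem ne_bot_iff {a : RegOpens X} : a ≠ ⊥ ↔ (a : Set X).Nonempty := by
  rw [Set.nonempty_iff_ne_empty]
  exact (SetLike.coe_injective.ne_iff (x := a) (y := ⊥)).symm

theorem closure_ofSet_subset (s : Set X) : closure (ofSet s : Set X) ⊆ closure s :=
  closure_minimal interior_subset isClosed_closure

theorem mem_closure_inf {a c : RegOpens X} {x : X} (hc : x ∈ c) (ha : x ∈ closure (a : Set X)) :
    x ∈ closure ((a ⊓ c : RegOpens X) : Set X) :=
  c.isOpen.closure_inter ⟨ha, hc⟩

theorem closure_subset_compl {a b : RegOpens X}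
    (h : Disjoint (closure (a : Set X)) (closure (b : Set X))) :
    closure (a : Set X) ⊆ (bᶜ : RegOpens X) := by
  rw [coe_compl]
  exact h.subset_compl_right

/-- The way-below relation between regular open sets. -/
def ll (a b : RegOpens X) : Prop := IsCompact (closure (a : Set X)) ∧ closure (a : Set X) ⊆ b

theorem ll_top_iff {a : RegOpens X} : ll a ⊤ ↔ IsCompact (closure (a : Set X)) :=
  ⟨fun h => h.1, fun h => ⟨h, fun x _ => mem_top x⟩⟩

/-- The regular open neighbourhoods of a point. -/
noncomputable def nhdsFilter (x : X) : PFilter (RegOpens X) :=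
  IsPFilter.toPFilter (F := {a : RegOpens X | x ∈ a})
    (IsPFilter.of_def ⟨⊤, mem_top x⟩
      (fun a ha b hb => ⟨a ⊓ b, ⟨ha, hb⟩, inf_le_left, inf_le_right⟩) fun hab ha => hab ha)

theorem exists_isUltra_nhdsFilter (x : X) :
    ∃ u : PFilter (RegOpens X), IsUltra u ∧ ∀ a : RegOpens X, x ∈ a → a ∈ u :=
  exists_isUltra_ge (nhdsFilter x) (notMem_bot x)

theorem mem_closure_of_nhds {u : PFilter (RegOpens X)} (hu : IsUltra u) {x : X}
    (h : ∀ a : RegOpens X, x ∈ a → a ∈ u) {a : RegOpens X} (ha : a ∈ u) :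
    x ∈ closure (a : Set X) := by
  by_contra h1
  have h2 := PFilter.inf_mem ha (h _ (mem_compl.2 h1))
  rw [inf_compl_eq_bot] at h2
  exact hu.1 h2

/-- Converse of `mem_closure_of_nhds`: an ultrafilter clustering at `x` contains every regular open
neighbourhood of `x`, since `aᶜ ∈ u` would make `x` adherent to `a ⊓ aᶜ`. -/
theorem mem_of_closure {u : PFilter (RegOpens X)} (hu : IsUltra u) {x : X}
    (h : ∀ a ∈ u, x ∈ closure (a : Set X)) {a : RegOpens X} (ha : x ∈ a) : a ∈ u := by
  refine (hu.2 a).resolve_right fun h1 => ?_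
  have h2 := mem_closure_inf ha (h _ h1)
  rw [inf_comm, inf_compl_eq_bot] at h2
  rw [closure_coe_bot] at h2
  exact h2

theorem exists_mem_closure_of_directedOn {S : Set (RegOpens X)} (hS : DirectedOn (· ≥ ·) S)
    (hbot : ⊥ ∉ S) {c : RegOpens X} (hc : c ∈ S) (hcc : IsCompact (closure (c : Set X))) :
    ∃ x : X, ∀ a ∈ S, x ∈ closure (a : Set X) := by
  -- Restricting to the members below `c` makes all the closures compact without changing the common
  -- points.
  let ι := {a : RegOpens X // a ∈ S ∧ a ≤ c}
  have : Nonempty ι := ⟨⟨c, hc, le_rfl⟩⟩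
  obtain ⟨x, hx⟩ := IsCompact.nonempty_iInter_of_directed_nonempty_isCompact_isClosed
    (fun i : ι => closure (i.1 : Set X))
    (fun i j => by
      obtain ⟨k, hk, hki, hkj⟩ := hS _ i.2.1 _ j.2.1
      exact ⟨⟨k, hk, le_trans hki i.2.2⟩, closure_mono hki, closure_mono hkj⟩)
    (fun i => (ne_bot_iff.1 fun h => hbot (h ▸ i.2.1)).closure)
    (fun i => hcc.of_isClosed_subset isClosed_closure (closure_mono i.2.2))
    (fun i => isClosed_closure)
  refine ⟨x, fun a ha => ?_⟩
  obtain ⟨k, hk, hka, hkc⟩ := hS _ ha _ hc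
  exact closure_mono hka (Set.mem_iInter.1 hx ⟨k, hk, hkc⟩)

theorem exists_mem_closure_of_isUltra {u : PFilter (RegOpens X)} (hu : IsUltra u)
    (h : ∃ c ∈ u, ll c ⊤) : ∃ x : X, ∀ a ∈ u, x ∈ closure (a : Set X) := by
  obtain ⟨c, hc, hcc⟩ := h
  exact exists_mem_closure_of_directedOn u.directed hu.1 hc hcc.1

end Basic

/-! ### Regular open sets of a locally compact Hausdorff space as an MVD-algebra. -/

section LocallyCompact

variable {X : Type*} [TopologicalSpace X] [T2Space X] [LocallyCompactSpace X]

theorem exists_between {K U : Set X} (hK : IsCompact K) (hU : IsOpen U) (h : K ⊆ U) :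
    ∃ c : RegOpens X, K ⊆ c ∧ closure (c : Set X) ⊆ U ∧ IsCompact (closure (c : Set X)) := by
  obtain ⟨V, hV, hKV, hVU, hVc⟩ := exists_open_between_and_isCompact_closure hK hU h
  exact ⟨ofSet V, hKV.trans (subset_ofSet hV), (closure_ofSet_subset V).trans hVU,
    hVc.of_isClosed_subset isClosed_closure (closure_ofSet_subset V)⟩

theorem exists_mem_closure_subset {x : X} {U : Set X} (hU : IsOpen U) (hx : x ∈ U) :
    ∃ c : RegOpens X, x ∈ c ∧ closure (c : Set X) ⊆ U ∧ IsCompact (closure (c : Set X)) := by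
  obtain ⟨c, h1, h2, h3⟩ := exists_between isCompact_singleton hU (Set.singleton_subset_iff.2 hx)
  exact ⟨c, Set.singleton_subset_iff.1 h1, h2, h3⟩

theorem isMVDAlgebra : IsMVDAlgebra (ll (X := X)) where
  ll1 a b h := subset_closure.trans h.2
  ll2 := by
    rw [ll, closure_coe_bot]
    exact ⟨isCompact_empty, Set.Subset.rfl⟩
  ll3 a b c t hab hbc hct :=
    ⟨hbc.1.of_isClosed_subset isClosed_closure (closure_mono hab),
      (closure_mono hab).trans (hbc.2.trans hct)⟩
  ll4 a b c hac hbc := by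
    -- The join is a regularised union, and regularising does not enlarge the closure.
    have h : closure ((a ⊔ b : RegOpens X) : Set X) ⊆ closure a ∪ closure b := by
      rw [← closure_union]
      refine le_trans (closure_mono ?_) (closure_ofSet_subset _)
      exact sup_le (a := a) (b := b)
        (Set.subset_union_left.trans (subset_ofSet (a.isOpen.union b.isOpen)))
        (Set.subset_union_right.trans (subset_ofSet (a.isOpen.union b.isOpen)))
    exact ⟨(hac.1.union hbc.1).of_isClosed_subset isClosed_closure h,
      h.trans (Set.union_subset hac.2 hbc.2)⟩
  ll5 a c hac := by
    obtain ⟨b, h1, h2, h3⟩ := exists_between hac.1 c.isOpen hac.2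
    exact ⟨b, ⟨hac.1, h1⟩, h3, h2⟩
  ll6 a ha := by
    obtain ⟨x, hx⟩ := ne_bot_iff.1 ha
    obtain ⟨b, h1, h2, h3⟩ := exists_mem_closure_subset a.isOpen hx
    exact ⟨b, ne_bot_iff.2 ⟨x, h1⟩, h3, h2⟩
  ll4' a b c hab hac := ⟨hab.1, Set.subset_inter hab.2 hac.2⟩
  mvd a b ha hab := by
    refine ⟨ha.1, fun x hx => ?_⟩
    by_contra h1
    have h2 : x ∉ bᶜᶜ := by rwa [compl_compl]
    rw [mem_compl, not_not] at h2
    exact mem_compl.1 (hab.2 h2) hx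

/-- Cutting down by bounded `c` removes the compactness built into `ll`: the pattern in (S1) says
only that the closure of `a` lies in `b`, tested near each point on a relatively compact
neighbourhood. -/
theorem closure_subset_iff {a b : RegOpens X} :
    (∀ c : RegOpens X, ll c ⊤ → ll (c ⊓ a) (cᶜ ⊔ b)) ↔ closure (a : Set X) ⊆ b := by
  constructor
  · intro h x hx
    obtain ⟨c, hxc, -, hc⟩ := exists_mem_closure_subset isOpen_univ (Set.mem_univ x)
    have h1 : x ∈ cᶜ ⊔ b := (h c (ll_top_iff.2 hc)).2 (by
      rw [inf_comm]
      exact mem_closure_inf hxc hx)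
    have h2 : c ⊓ (cᶜ ⊔ b) ≤ b := by
      rw [inf_sup_left, inf_compl_eq_bot, bot_sup_eq]
      exact inf_le_right
    exact h2 ⟨hxc, h1⟩
  · intro h c hc
    exact ⟨hc.1.of_isClosed_subset isClosed_closure
      (closure_mono (inf_le_left : c ⊓ a ≤ c)),
      (closure_mono (inf_le_right : c ⊓ a ≤ a)).trans
        (h.trans (le_sup_right : b ≤ cᶜ ⊔ b))⟩

end LocallyCompact

/-! ### Continuous open maps induce complete Boolean homomorphisms. -/

section Preimage

variable {X Y : Type*} [TopologicalSpace X] [TopologicalSpace Y]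

/-- The preimage of a regular open set under a continuous open map. -/
def preimage (f : X → Y) (hf : Continuous f) (hfo : IsOpenMap f) (a : RegOpens Y) : RegOpens X :=
  mk (f ⁻¹' a) (by
    rw [← hfo.preimage_closure_eq_closure_preimage hf,
      ← hfo.preimage_interior_eq_interior_preimage hf, interior_closure])

theorem coe_preimage (f : X → Y) (hf : Continuous f) (hfo : IsOpenMap f) (a : RegOpens Y) :
    (preimage f hf hfo a : Set X) = f ⁻¹' a := rfl

theorem gc_preimage (f : X → Y) (hf : Continuous f) (hfo : IsOpenMap f) :
    GaloisConnection (fun a : RegOpens X => ofSet (f '' a)) (preimage f hf hfo) := by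
  intro a b
  rw [ofSet_le_iff (hfo _ a.isOpen), Set.image_subset_iff]
  rfl

theorem preimage_compl (f : X → Y) (hf : Continuous f) (hfo : IsOpenMap f) (a : RegOpens Y) :
    preimage f hf hfo aᶜ = (preimage f hf hfo a)ᶜ := by
  refine SetLike.coe_injective ?_
  rw [coe_preimage, coe_compl, coe_compl, coe_preimage,
    ← hfo.preimage_closure_eq_closure_preimage hf, Set.preimage_compl]

/-- Taking preimages under a continuous open map, as a complete Boolean homomorphism. -/
noncomputable def preimageHom (f : X → Y) (hf : Continuous f) (hfo : IsOpenMap f) :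
    CompleteLatticeHom (RegOpens Y) (RegOpens X) where
  toFun := preimage f hf hfo
  map_sInf' s := by
    rw [(gc_preimage f hf hfo).u_sInf, sInf_image]
  map_sSup' s := by
    -- Meets are preserved by a right adjoint; joins follow by complementation.
    rw [← compl_inj_iff, ← preimage_compl, compl_sSup', compl_sSup',
      (gc_preimage f hf hfo).u_sInf, ← sInf_image, ← Set.image_comp, ← Set.image_comp]
    simp only [Function.comp_def, preimage_compl]

theorem coe_preimageHom (f : X → Y) (hf : Continuous f) (hfo : IsOpenMap f) (a : RegOpens Y) :
    (preimageHom f hf hfo a : Set X) = f ⁻¹' a := rfl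

theorem lowerAdjoint_preimageHom (f : X → Y) (hf : Continuous f) (hfo : IsOpenMap f)
    (a : RegOpens X) : lowerAdjoint (preimageHom f hf hfo) a = ofSet (f '' a) :=
  (lowerAdjoint_gc _).l_unique (gc_preimage f hf hfo) fun _ => rfl

/-- The image of a compact closure is compact, hence closed, so it absorbs the regularisation of `f
'' a`. -/
theorem closure_lowerAdjoint_subset [T2Space Y] (f : X → Y) (hf : Continuous f) (hfo : IsOpenMap f)
    {a : RegOpens X} (ha : IsCompact (closure (a : Set X))) :
    closure ((lowerAdjoint (preimageHom f hf hfo) a : RegOpens Y) : Set Y) ⊆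
      f '' closure (a : Set X) := by
  rw [lowerAdjoint_preimageHom]
  exact (closure_ofSet_subset _).trans
    (closure_minimal (Set.image_mono subset_closure) (ha.image hf).isClosed)

theorem isIIOALMorphism_preimageHom [T2Space X] [LocallyCompactSpace X] [T2Space Y]
    [LocallyCompactSpace Y] (f : X → Y) (hf : Continuous f) (hfo : IsOpenMap f)
    (hfs : Function.Surjective f) : IsIIOALMorphism ll ll (preimageHom f hf hfo) where
  s1 a b := by
    rw [closure_subset_iff, closure_subset_iff, coe_preimageHom, coe_preimageHom,
      ← hfo.preimage_closure_eq_closure_preimage hf]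
    exact Set.preimage_mono
  s2 a ha := ll_top_iff.2 ((ha.1.image hf).of_isClosed_subset isClosed_closure
    (closure_lowerAdjoint_subset f hf hfo ha.1))
  is' u hu hub := by
    -- A bounded ultrafilter clusters at a point; lift it through `f` and take an ultrafilter of
    -- neighbourhoods upstairs. The point `f x` then lies in both closures and witnesses the
    -- contact.
    obtain ⟨y, hy⟩ := exists_mem_closure_of_isUltra hu hub
    obtain ⟨x, rfl⟩ := hfs y
    obtain ⟨v, hv, hxv⟩ := exists_isUltra_nhdsFilter x
    obtain ⟨c, hxc, -, hc⟩ := exists_mem_closure_subset isOpen_univ (Set.mem_univ x)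
    refine ⟨v, hv, ⟨c, hxv c hxc, ll_top_iff.2 hc⟩, fun a ha b hb => ?_⟩
    obtain ⟨d, hxd, -, hd⟩ := exists_mem_closure_subset isOpen_univ (Set.mem_univ (f x))
    refine ⟨d, ll_top_iff.2 hd, fun h => ?_⟩
    refine mem_compl.1 (h.2 (mem_closure_inf hxd ?_)) (mem_closure_inf hxd (hy a ha))
    rw [lowerAdjoint_preimageHom]
    exact closure_mono (subset_ofSet (hfo _ b.isOpen))
      (image_closure_subset_closure_image hf ⟨x, mem_closure_of_nhds hv hxv hb, rfl⟩)
  so a b h := by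
    have h1 := closure_lowerAdjoint_subset f hf hfo h.1
    exact ⟨(h.1.image hf).of_isClosed_subset isClosed_closure h1,
      h1.trans (Set.image_subset_iff.2 h.2)⟩

end Preimage

end RegOpens

/-! ### Morphisms between algebras of regular open sets come from maps -/

namespace RegOpens

section Full

variable {X Y : Type*} [TopologicalSpace X] [TopologicalSpace Y] [T2Space X]
  [LocallyCompactSpace X] [T2Space Y] [LocallyCompactSpace Y]
  {ψ : CompleteLatticeHom (RegOpens Y) (RegOpens X)}

/-- The sets `ψ_Λ V` with `x ∈ V` should shrink to the image of `x`; (S2) makes one of their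
closures compact, so a common adherent point `y` exists. -/
theorem exists_point_of_isIIOALMorphism (hψ : IsIIOALMorphism ll ll ψ) (x : X) :
    ∃ y : Y, ∀ U : RegOpens Y, x ∈ ψ U ↔ y ∈ U := by
  have hgc := lowerAdjoint_gc ψ
  obtain ⟨c, hxc, -, hc⟩ := exists_mem_closure_subset isOpen_univ (Set.mem_univ x)
  obtain ⟨y, hy⟩ := exists_mem_closure_of_directedOn
    (S := lowerAdjoint ψ '' {V : RegOpens X | x ∈ V}) (by
      rintro _ ⟨V, hV, rfl⟩ _ ⟨W, hW, rfl⟩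
      exact ⟨_, ⟨V ⊓ W, mem_inf.2 ⟨hV, hW⟩, rfl⟩, hgc.monotone_l inf_le_left,
        hgc.monotone_l inf_le_right⟩) (by
      rintro ⟨V, hV, h⟩
      have h1 := hgc.le_u_l V
      rw [h, map_bot] at h1
      exact notMem_bot x (h1 hV)) ⟨c, hxc, rfl⟩ (hψ.s2 _ (ll_top_iff.2 hc)).1
  refine ⟨y, fun U => ⟨fun hx => ?_, fun hyU => ?_⟩⟩
  · obtain ⟨V, hxV, hVU, hV⟩ := exists_mem_closure_subset (ψ U).isOpen hx
    exact (hψ.so U V ⟨hV, hVU⟩).2 (hy _ ⟨V, hxV, rfl⟩)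
  -- If `x ∉ ψ U`, then (S1) keeps `x` off the closure of `ψ W`, so `x ∈ ψ Wᶜ`; hence `y` is
  -- adherent to `Wᶜ`, contradicting `y ∈ W`.
  · obtain ⟨W, hyW, hWU, hW⟩ := exists_mem_closure_subset U.isOpen hyU
    have h1 : closure (ψ W : Set X) ⊆ ψ U :=
      closure_subset_iff.1 (hψ.s1 W U (closure_subset_iff.2 hWU))
    by_contra hx
    have h2 : x ∈ ψ Wᶜ := by
      rw [map_compl', mem_compl]
      exact fun h => hx (h1 h)
    have h3 := closure_mono (le_iff.1 (hgc.l_u_le Wᶜ)) (hy _ ⟨_, h2, rfl⟩)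
    have h4 := mem_closure_inf hyW h3
    rw [inf_comm, inf_compl_eq_bot, closure_coe_bot] at h4
    exact h4

theorem exists_map_of_isIIOALMorphism (hψ : IsIIOALMorphism ll ll ψ) :
    ∃ (f : X → Y) (hf : Continuous f) (hfo : IsOpenMap f),
      Function.Surjective f ∧ preimageHom f hf hfo = ψ := by
  choose f hfψ using exists_point_of_isIIOALMorphism hψ
  have hgc := lowerAdjoint_gc ψ
  have hf : Continuous f := by
    refine continuous_iff_continuousAt.2 fun x => ?_
    intro s hs
    obtain ⟨t, hts, ht, hxt⟩ := mem_nhds_iff.1 hs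
    obtain ⟨U, hxU, hUt, -⟩ := exists_mem_closure_subset ht hxt
    refine Filter.mem_map.2 (Filter.mem_of_superset
      ((ψ U).isOpen.mem_nhds ((hfψ x U).2 hxU)) fun z hz => ?_)
    exact hts (hUt (subset_closure ((hfψ z U).1 hz)))
  -- A point outside the compact set `f '' closure W` is separated from it by a regular open `U`,
  -- and `W ≤ ψ U` gives `ψ_Λ W ≤ U`. Openness of `f` follows, as `ψ_Λ W` is a neighbourhood of `f
  -- x` for every `x ∈ W`.
  have hle : ∀ W : RegOpens X, IsCompact (closure (W : Set X)) →
      closure ((lowerAdjoint ψ W : RegOpens Y) : Set Y) ⊆ f '' closure (W : Set X) := by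
    intro W hW y hy
    by_contra hyW
    obtain ⟨U, hWU, hUy, -⟩ := exists_between (hW.image hf) isOpen_compl_singleton
      (Set.subset_compl_singleton_iff.2 hyW)
    have h1 : lowerAdjoint ψ W ≤ U := (hgc W U).2 fun x hx =>
      (hfψ x U).2 (hWU ⟨x, subset_closure hx, rfl⟩)
    exact hUy (closure_mono h1 hy) rfl
  have hfo : IsOpenMap f := by
    intro V hV
    refine isOpen_iff_mem_nhds.2 ?_
    rintro _ ⟨x, hx, rfl⟩
    obtain ⟨W, hxW, hWV, hW⟩ := exists_mem_closure_subset hV hx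
    refine Filter.mem_of_superset ((lowerAdjoint ψ W).isOpen.mem_nhds
      ((hfψ x _).1 (hgc.le_u_l W hxW))) ?_
    exact subset_closure.trans ((hle W hW).trans (Set.image_mono hWV))
  refine ⟨f, hf, hfo, fun y => ?_, ?_⟩
  -- Surjectivity: (IS') turns an ultrafilter at `y` into one clustering at some `x`. If `f x ≠ y`,
  -- neighbourhoods with disjoint closures contradict the contact.
  · obtain ⟨u, hu, hyu⟩ := exists_isUltra_nhdsFilter y
    obtain ⟨c, hyc, -, hc⟩ := exists_mem_closure_subset isOpen_univ (Set.mem_univ y)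
    obtain ⟨v, hv, hvb, huv⟩ := hψ.is' u hu ⟨c, hyu c hyc, ll_top_iff.2 hc⟩
    obtain ⟨x, hx⟩ := exists_mem_closure_of_isUltra hv hvb
    refine ⟨x, ?_⟩
    by_contra hne
    obtain ⟨s, hxs, hs, t, hyt, ht, hst⟩ := exists_open_nhds_disjoint_closure hne
    obtain ⟨U, hxU, hUs, -⟩ := exists_mem_closure_subset hs hxs
    obtain ⟨U', hyU', hUt, -⟩ := exists_mem_closure_subset ht hyt
    obtain ⟨d, hd, h⟩ := huv U' (hyu _ hyU') (ψ U) (mem_of_closure hv hx ((hfψ x U).2 hxU))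
    refine h ⟨hd.1.of_isClosed_subset isClosed_closure (closure_mono (le_iff.1 inf_le_right)),
      closure_subset_compl (hst.mono ?_ ?_)⟩
    · exact ((closure_mono (le_iff.1 (inf_le_left.trans (hgc.l_u_le U)))).trans hUs).trans
        subset_closure
    · exact ((closure_mono (le_iff.1 inf_le_left)).trans hUt).trans subset_closure
  · refine DFunLike.ext _ _ fun U => SetLike.ext fun x => ?_
    rw [hfψ]
    rfl

end Full

end RegOpens

/-! ### The contravariant functor of regular open sets -/

/-- The MVD-algebra of regular open subsets of a locally compact Hausdorff space. -/
noncomputable def SOLC.regOpens (X : SOLC.{u}) : IIOAL.{u} :=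
  ⟨RegOpens X.carrier, RegOpens.ll, RegOpens.isMVDAlgebra⟩

/-- The functor sending a locally compact Hausdorff space to its regular open sets and a surjective
open map to the preimage homomorphism. -/
noncomputable def SOLC.toIIOAL : SOLC.{u}ᵒᵖ ⥤ IIOAL.{u} where
  obj X := X.unop.regOpens
  map f := ⟨RegOpens.preimageHom f.unop.toMap f.unop.toMap.continuous f.unop.isOpenMap,
    RegOpens.isIIOALMorphism_preimageHom _ _ _ f.unop.surjective⟩

instance : SOLC.toIIOAL.{u}.Faithful where
  map_injective {X Y f g} h := by
    refine Quiver.Hom.unop_inj (SOLC.Hom.ext (ContinuousMap.ext fun x => ?_))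
    by_contra hne
    obtain ⟨U, hxU, hUy, -⟩ := RegOpens.exists_mem_closure_subset
      (isOpen_compl_singleton (x := g.unop.toMap x)) hne
    have h1 := congrArg (fun k : IIOAL.Hom X.unop.regOpens Y.unop.regOpens =>
      SetLike.coe (show RegOpens Y.unop.carrier from k.toHom U)) h
    have h2 : f.unop.toMap ⁻¹' U = g.unop.toMap ⁻¹' U := h1
    have h3 : x ∈ g.unop.toMap ⁻¹' U := h2 ▸ hxU
    exact hUy (subset_closure h3) rfl

instance : SOLC.toIIOAL.{u}.Full where
  map_surjective {X Y} k := by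
    obtain ⟨f, hf, hfo, hfs, h⟩ := RegOpens.exists_map_of_isIIOALMorphism (X := Y.unop.carrier)
      (Y := X.unop.carrier) k.prop
    exact ⟨Quiver.Hom.op (⟨⟨f, hf⟩, hfo, hfs⟩ : SOLC.Hom Y.unop X.unop), IIOAL.Hom.ext h⟩

/-! ### The dual space of an MVD-algebra -/

namespace IsMVDAlgebra

variable {B : Type*} [BooleanAlgebra B] {ll : B → B → Prop}

theorem ll_top (h : IsMVDAlgebra ll) {a b : B} (hab : ll a b) : ll a ⊤ :=
  h.ll3 _ _ _ _ le_rfl hab le_top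

theorem inf_ll_inf (h : IsMVDAlgebra ll) {a b c d : B} (hab : ll a b) (hcd : ll c d) :
    ll (a ⊓ c) (b ⊓ d) :=
  h.ll4' _ _ _ (h.ll3 _ _ _ _ inf_le_left hab le_rfl) (h.ll3 _ _ _ _ inf_le_right hcd le_rfl)

end IsMVDAlgebra

/-- The points of the dual space of an MVD-algebra: the proper round filters that contain `aᶜ` or
`b` whenever `a ≪ b`. -/
structure IsRoundPrime {B : Type*} [BooleanAlgebra B] (ll : B → B → Prop) (x : PFilter B) :
    Prop where
  bot_notMem : ⊥ ∉ x
  round : ∀ b ∈ x, ∃ a ∈ x, ll a b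
  compl_or : ∀ a b, ll a b → aᶜ ∈ x ∨ b ∈ x

/-- The dual space of an MVD-algebra. -/
def DualSpace {B : Type*} [BooleanAlgebra B] {ll : B → B → Prop} (_ : IsMVDAlgebra ll) : Type _ :=
  {x : PFilter B // IsRoundPrime ll x}

namespace DualSpace

section BooleanAlgebra

variable {B : Type*} [BooleanAlgebra B] {ll : B → B → Prop} {h : IsMVDAlgebra ll}

/-- The basic open set of points containing `b`. -/
def basic (h : IsMVDAlgebra ll) (b : B) : Set (DualSpace h) := {x | b ∈ x.1}

theorem basic_inf (a b : B) : basic h (a ⊓ b) = basic h a ∩ basic h b :=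
  Set.ext fun _ => PFilter.inf_mem_iff

theorem basic_mono {a b : B} (hab : a ≤ b) : basic h a ⊆ basic h b :=
  fun _ hx => PFilter.mem_of_le hab hx

theorem basic_bot : basic h ⊥ = ∅ := Set.eq_empty_of_forall_notMem fun x => x.2.bot_notMem

theorem disjoint_basic_compl (a : B) : Disjoint (basic h a) (basic h aᶜ) := by
  rw [Set.disjoint_iff_inter_eq_empty, ← basic_inf, inf_compl_eq_bot, basic_bot]

instance : TopologicalSpace (DualSpace h) :=
  TopologicalSpace.generateFrom (Set.range (basic h))

theorem isTopologicalBasis : TopologicalSpace.IsTopologicalBasis (Set.range (basic h)) where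
  exists_subset_inter := by
    rintro _ ⟨a, rfl⟩ _ ⟨b, rfl⟩ x hx
    exact ⟨_, ⟨a ⊓ b, rfl⟩, by rwa [basic_inf], by rw [basic_inf]⟩
  sUnion_eq := by
    refine Set.eq_univ_of_forall fun x => ?_
    obtain ⟨b, hb⟩ := x.1.nonempty
    exact ⟨_, ⟨b, rfl⟩, hb⟩
  eq_generateFrom := rfl

theorem isOpen_basic (b : B) : IsOpen (basic h b) := isTopologicalBasis.isOpen ⟨b, rfl⟩

theorem exists_basic_subset {x : DualSpace h} {U : Set (DualSpace h)} (hU : IsOpen U)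
    (hx : x ∈ U) : ∃ b, x ∈ basic h b ∧ basic h b ⊆ U := by
  obtain ⟨_, ⟨b, rfl⟩, h1, h2⟩ := isTopologicalBasis.exists_subset_of_mem_open hx hU
  exact ⟨b, h1, h2⟩

/-- A proper filter that contains a bounded element, and `aᶜ` or `b` whenever `a ≪ b`, contains a
point of the dual space. -/
theorem exists_point (h : IsMVDAlgebra ll) (u : PFilter B) (hbot : ⊥ ∉ u) {c : B} (hc : c ∈ u)
    (hcb : ll c ⊤) (hu : ∀ a b, ll a b → aᶜ ∈ u ∨ b ∈ u) :
    ∃ x : DualSpace h, ∀ b, b ∈ x.1 ↔ ∃ a ∈ u, ll a b := by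
  have hF : IsPFilter {b | ∃ a ∈ u, ll a b} := by
    refine IsPFilter.of_def ⟨⊤, c, hc, hcb⟩ ?_ ?_
    · rintro a ⟨a', ha', ha⟩ b ⟨b', hb', hb⟩
      exact ⟨a ⊓ b, ⟨_, PFilter.inf_mem ha' hb', h.inf_ll_inf ha hb⟩, inf_le_left, inf_le_right⟩
    · rintro a b hab ⟨a', ha', ha⟩
      exact ⟨a', ha', h.ll3 _ _ _ _ le_rfl ha hab⟩
  refine ⟨⟨hF.toPFilter, ?_, ?_, ?_⟩, fun b => Iff.rfl⟩
  · rintro ⟨a, ha, hab⟩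
    exact hbot (PFilter.mem_of_le (h.ll1 _ _ hab) ha)
  · rintro b ⟨a, ha, hab⟩
    obtain ⟨d, had, hdb⟩ := h.ll5 _ _ hab
    exact ⟨d, ⟨a, ha, had⟩, hdb⟩
  · intro a b hab
    -- Interpolate `a ≪ d ≪ e ≪ b` and apply `hu` to the middle pair, leaving room for roundness on
    -- both sides. Meeting `dᶜ` with the bounded `c` is what allows `a ≪ d` to be complemented.
    obtain ⟨d, had, hdb⟩ := h.ll5 _ _ hab
    obtain ⟨e, hde, heb⟩ := h.ll5 _ _ hdb
    rcases hu d e hde with h1 | h1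
    · refine Or.inl ⟨dᶜ ⊓ c, PFilter.inf_mem h1 hc, ?_⟩
      refine h.ll_compl_comm (h.ll3 _ _ _ _ inf_le_right hcb le_rfl) ?_
      refine h.ll3 _ _ _ _ le_rfl had ?_
      rw [compl_inf, compl_compl]
      exact le_sup_left
    · exact Or.inr ⟨e, h1, heb⟩

/-- Any nonzero `a ≪ b` is bounded, so the round part of an ultrafilter through `a` is a point
containing `b`. -/
theorem basic_nonempty (h : IsMVDAlgebra ll) {b : B} (hb : b ≠ ⊥) : (basic h b).Nonempty := by
  obtain ⟨a, ha, hab⟩ := h.ll6 b hb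
  obtain ⟨u, hu, hau⟩ := exists_isUltra_ge (PFilter.principal a)
    fun h1 => ha (le_bot_iff.1 (PFilter.mem_principal.1 h1))
  have hau' : a ∈ u := hau a (PFilter.mem_principal.2 le_rfl)
  obtain ⟨x, hx⟩ := exists_point h u hu.1 hau' (h.ll_top hab) fun c d hcd =>
    (hu.2 c).symm.imp_right (PFilter.mem_of_le (h.ll1 _ _ hcd))
  exact ⟨x, (hx b).2 ⟨a, hau', hab⟩⟩

theorem basic_subset_iff {a b : B} : basic h a ⊆ basic h b ↔ a ≤ b := by
  refine ⟨fun hab => ?_, basic_mono⟩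
  by_contra h1
  have h2 : a ⊓ bᶜ ≠ ⊥ := fun h2 => h1 (by simpa using (disjoint_iff.2 h2).le_compl_right)
  obtain ⟨x, hx⟩ := basic_nonempty h h2
  rw [basic_inf] at hx
  exact Set.disjoint_left.1 (disjoint_basic_compl b) (hab hx.1) hx.2

theorem disjoint_basic_iff {a b : B} : Disjoint (basic h a) (basic h b) ↔ a ≤ bᶜ := by
  constructor
  · intro hab
    by_contra h1
    have h2 : a ⊓ b ≠ ⊥ := fun h2 => h1 (disjoint_iff.2 h2).le_compl_right
    obtain ⟨x, hx⟩ := basic_nonempty h h2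
    rw [basic_inf] at hx
    exact Set.disjoint_left.1 hab hx.1 hx.2
  · intro hab
    exact ((disjoint_basic_compl b).mono_right (basic_mono hab)).symm

/-- The complement of the closure is a union of basic sets disjoint from `basic h a`, and each of
these comes from an element below `aᶜ`. -/
theorem closure_basic (a : B) : closure (basic h a) = (basic h aᶜ)ᶜ := by
  refine subset_antisymm (closure_minimal (disjoint_basic_compl a).subset_compl_right
    (isOpen_basic _).isClosed_compl) fun x hx => ?_
  by_contra h1
  obtain ⟨b, hxb, hb⟩ := exists_basic_subset isClosed_closure.isOpen_compl h1
  have h2 : b ≤ aᶜ := disjoint_basic_iff.1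
    (Set.disjoint_left.2 fun z hz hz' => hb hz (subset_closure hz'))
  exact hx (basic_mono h2 hxb)

theorem mem_closure_basic {a : B} {x : DualSpace h} :
    x ∈ closure (basic h a) ↔ x ∉ basic h aᶜ := by
  rw [closure_basic, Set.mem_compl_iff]

theorem closure_basic_subset {a b : B} (hab : ll a b) : closure (basic h a) ⊆ basic h b := by
  intro x hx
  have h1 : x ∉ basic h aᶜ := mem_closure_basic.1 hx
  exact (x.2.compl_or _ _ hab).resolve_left h1

instance : T2Space (DualSpace h) where
  t2 x y hxy := by
    -- Distinct points are incomparable: if `x ⊆ y`, then roundness of `y` and the prime condition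
    -- on `x` force `y ⊆ x`.
    have key : ∃ b ∈ x.1, b ∉ y.1 := by
      by_contra! h1
      refine hxy (Subtype.ext (SetLike.ext fun b => ⟨h1 b, fun hb => ?_⟩))
      obtain ⟨a, ha, hab⟩ := y.2.round b hb
      refine (x.2.compl_or _ _ hab).resolve_left fun h2 => ?_
      exact y.2.bot_notMem (inf_compl_eq_bot (a := a) ▸ PFilter.inf_mem ha (h1 _ h2))
    obtain ⟨b, hbx, hby⟩ := key
    obtain ⟨a, hax, hab⟩ := x.2.round b hbx
    exact ⟨basic h a, basic h aᶜ, isOpen_basic _, isOpen_basic _, hax,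
      (y.2.compl_or _ _ hab).resolve_right hby, disjoint_basic_compl a⟩

/-- The elements `b` with `basic h b` in a topological ultrafilter form a filter that need not be an
ultrafilter of the algebra, because `basic h b` and `basic h bᶜ` miss the boundary. It still
satisfies the weaker hypothesis of `exists_point`, which supplies the limit. -/
theorem isCompact_closure_basic {a : B} (ha : ll a ⊤) : IsCompact (closure (basic h a)) := by
  rw [isCompact_iff_ultrafilter_le_nhds]
  intro f hf
  obtain ⟨c, hac, hc⟩ := h.ll5 _ _ ha
  have hcf : basic h c ∈ f :=
    Filter.mem_of_superset (Filter.le_principal_iff.1 hf) (closure_basic_subset hac)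
  have hF : IsPFilter {b | basic h b ∈ f} := by
    refine IsPFilter.of_def ⟨c, hcf⟩ (fun a ha b hb => ⟨a ⊓ b, ?_, inf_le_left, inf_le_right⟩)
      fun hab ha => Filter.mem_of_superset ha (basic_mono hab)
    rw [Set.mem_ofPred_eq, basic_inf]
    exact Filter.inter_mem ha hb
  obtain ⟨x, hx⟩ := exists_point h hF.toPFilter (fun h1 => by
      have h2 : basic h ⊥ ∈ f := h1
      rw [basic_bot] at h2
      exact f.empty_notMem h2) (c := c) hcf hc (fun p q hpq => by
      have h1 : basic h pᶜ ∪ basic h q ∈ f :=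
        Filter.mem_of_superset Filter.univ_mem fun z _ => z.2.compl_or _ _ hpq
      exact Ultrafilter.union_mem_iff.1 h1)
  have hfx : ↑f ≤ nhds x := by
    intro s hs
    obtain ⟨U, hUs, hU, hxU⟩ := mem_nhds_iff.1 hs
    obtain ⟨b, hxb, hbU⟩ := exists_basic_subset hU hxU
    obtain ⟨d, hd, hdb⟩ := (hx b).1 hxb
    exact Filter.mem_of_superset hd ((basic_mono (h.ll1 _ _ hdb)).trans (hbU.trans hUs))
  exact ⟨x, isClosed_closure.mem_of_tendsto (f := id) (b := (f : Filter (DualSpace h))) hfx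
    (Filter.le_principal_iff.1 hf), hfx⟩

theorem ll_iff {a b : B} :
    ll a b ↔ IsCompact (closure (basic h a)) ∧ closure (basic h a) ⊆ basic h b := by
  refine ⟨fun hab => ⟨isCompact_closure_basic (h.ll_top hab), closure_basic_subset hab⟩, ?_⟩
  rintro ⟨hc, hab⟩
  have : Nonempty {c // ll c b} := ⟨⟨⊥, h.ll3 _ _ _ _ le_rfl h.ll2 bot_le⟩⟩
  -- By roundness the sets `basic h c` with `c ≪ b` cover `basic h b`, and they are directed under
  -- joins; compactness leaves a single `c` with `a ≤ c ≪ b`.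
  obtain ⟨⟨c, hcb⟩, hac⟩ := hc.elim_directed_cover (fun c : {c // ll c b} => basic h c.1)
    (fun c => isOpen_basic _) (fun x hx => by
      obtain ⟨c, hc, hcb⟩ := x.2.round b (hab hx)
      exact Set.mem_iUnion.2 ⟨⟨c, hcb⟩, hc⟩)
    (fun c d => ⟨⟨c.1 ⊔ d.1, h.ll4 _ _ _ c.2 d.2⟩, basic_mono le_sup_left,
      basic_mono le_sup_right⟩)
  exact h.ll3 _ _ _ _ (basic_subset_iff.1 (subset_closure.trans hac)) hcb le_rfl

instance : LocallyCompactSpace (DualSpace h) where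
  local_compact_nhds x s hs := by
    obtain ⟨U, hUs, hU, hxU⟩ := mem_nhds_iff.1 hs
    obtain ⟨b, hxb, hbU⟩ := exists_basic_subset hU hxU
    obtain ⟨a, ha, hab⟩ := x.2.round b hxb
    exact ⟨closure (basic h a), Filter.mem_of_superset ((isOpen_basic a).mem_nhds ha)
      subset_closure, (closure_basic_subset hab).trans (hbU.trans hUs),
      isCompact_closure_basic (h.ll_top hab)⟩

/-- A basic open set as a regular open set. -/
def regOpen (h : IsMVDAlgebra ll) (b : B) : RegOpens (DualSpace h) :=
  RegOpens.mk (basic h b) (by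
    rw [closure_basic, interior_compl, closure_basic, compl_compl, compl_compl])

theorem coe_regOpen (b : B) : (regOpen h b : Set (DualSpace h)) = basic h b := rfl

end BooleanAlgebra

/-! ### Role of completeness: every regular open set of the dual space is basic. -/

section Complete

variable {B : Type*} [CompleteBooleanAlgebra B] {ll : B → B → Prop} {h : IsMVDAlgebra ll}

theorem closure_eq_closure_basic {U : Set (DualSpace h)} (hU : IsOpen U) :
    closure U = closure (basic h (sSup {b | basic h b ⊆ U})) := by
  refine subset_antisymm (closure_mono fun x hx => ?_) (closure_minimal ?_ isClosed_closure)
  · obtain ⟨b, hxb, hbU⟩ := exists_basic_subset hU hx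
    exact basic_mono (le_sSup hbU) hxb
  · intro x hx
    by_contra h1
    obtain ⟨c, hxc, hc⟩ := exists_basic_subset isClosed_closure.isOpen_compl h1
    -- The supremum may exceed the union of the basic sets, but not beyond the closure: a `c`
    -- disjoint from every `b` is disjoint from their join.
    have h2 : sSup {b | basic h b ⊆ U} ≤ cᶜ := sSup_le fun b hb => disjoint_basic_iff.1
      (Set.disjoint_left.2 fun z hz hz' => hc hz' (subset_closure (hb hz)))
    exact Set.disjoint_left.1 (disjoint_basic_compl c) hxc (basic_mono h2 hx)

/-- A complete MVD-algebra is isomorphic to the regular open sets of its dual space. -/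
noncomputable def orderIso (h : IsMVDAlgebra ll) : B ≃o RegOpens (DualSpace h) where
  toEquiv := Equiv.ofBijective (regOpen h) ⟨fun a b hab => le_antisymm
      (basic_subset_iff.1 (congrArg SetLike.coe hab).subset)
      (basic_subset_iff.1 (congrArg SetLike.coe hab).superset), fun U => by
    refine ⟨sSup {b | basic h b ⊆ (U : Set (DualSpace h))}, SetLike.coe_injective ?_⟩
    refine (RegOpens.interior_closure _).symm.trans (Eq.trans ?_ (RegOpens.interior_closure U))
    rw [coe_regOpen, ← closure_eq_closure_basic U.isOpen]⟩
  map_rel_iff' := basic_subset_iff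

theorem ll_orderIso_iff {a b : B} : RegOpens.ll (orderIso h a) (orderIso h b) ↔ ll a b :=
  ll_iff.symm

end Complete

end DualSpace

/-! ### The equivalence -/

theorem lowerAdjoint_orderIso {A B : Type*} [CompleteBooleanAlgebra A] [CompleteBooleanAlgebra B]
    (e : A ≃o B) (b : B) : lowerAdjoint (e : CompleteLatticeHom A B) b = e.symm b :=
  (lowerAdjoint_gc _).l_unique e.symm.to_galoisConnection fun _ => rfl

theorem isIIOALMorphism_orderIso {A B : Type*} [CompleteBooleanAlgebra A]
    [CompleteBooleanAlgebra B] {llA : A → A → Prop} {llB : B → B → Prop} (hA : IsMVDAlgebra llA)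
    (e : A ≃o B) (he : ∀ a b, llB (e a) (e b) ↔ llA a b) :
    IsIIOALMorphism llA llB (e : CompleteLatticeHom A B) := by
  have he' : ∀ a b, llB a (e b) ↔ llA (e.symm a) b := fun a b => by
    rw [← he, e.apply_symm_apply]
  refine ⟨fun a b hab d hd => ?_, fun b hb => ?_, fun u hu hub => ?_, fun a b hab => ?_⟩
  · have h1 := hab (e.symm d) ((he' d ⊤).1 (by rwa [map_top]))
    rw [← he, map_inf, map_sup, map_compl', e.apply_symm_apply] at h1
    exact h1
  · rw [lowerAdjoint_orderIso, ← he', map_top]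
    exact hb
  -- For an isomorphism, the image of `u` under `e` serves as `v`, and any bounded `c ∈ u` witnesses
  -- the contact.
  · have hF : IsPFilter {b | e.symm b ∈ u} := by
      refine IsPFilter.of_def ⟨⊤, ?_⟩ (fun a ha b hb => ⟨a ⊓ b, ?_, inf_le_left, inf_le_right⟩)
        fun hab ha => PFilter.mem_of_le (e.symm.monotone hab) ha
      · rw [Set.mem_ofPred_eq, map_top]
        exact PFilter.top_mem
      · rw [Set.mem_ofPred_eq, map_inf]
        exact PFilter.inf_mem ha hb
    have hmem : ∀ b, b ∈ hF.toPFilter ↔ e.symm b ∈ u := fun b => Iff.rfl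
    refine ⟨hF.toPFilter, ⟨?_, fun b => ?_⟩, ?_, fun a ha b hb => ?_⟩
    · rw [hmem, map_bot]
      exact hu.1
    · rw [hmem, hmem, map_compl']
      exact hu.2 _
    · obtain ⟨c, hc, hcb⟩ := hub
      refine ⟨e c, (hmem _).2 (by rwa [e.symm_apply_apply]), ?_⟩
      rwa [← map_top e, he]
    · rw [lowerAdjoint_orderIso]
      obtain ⟨c, hc, hcb⟩ := hub
      refine ⟨c, hcb, fun h2 => hu.1 ?_⟩
      have h3 : (e.symm b ⊓ c) ⊓ (a ⊓ c) ≤ ⊥ :=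
        (le_compl_iff_disjoint_right.1 (hA.ll1 _ _ h2)).le_bot
      exact PFilter.mem_of_le h3 (PFilter.inf_mem (PFilter.inf_mem hb hc) (PFilter.inf_mem ha hc))
  · rw [lowerAdjoint_orderIso]
    exact (he' _ _).1 hab

/-- An order isomorphism that preserves and reflects `≪` is an isomorphism of MVD-algebras. -/
def IIOAL.isoOfOrderIso {X Y : IIOAL.{u}} (e : X.carrier ≃o Y.carrier)
    (he : ∀ a b, Y.ll (e a) (e b) ↔ X.ll a b) : X ≅ Y where
  hom := ⟨e, isIIOALMorphism_orderIso X.isMVDAlgebra e he⟩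
  inv := ⟨e.symm, isIIOALMorphism_orderIso Y.isMVDAlgebra e.symm fun a b => by
    rw [← he, e.apply_symm_apply, e.apply_symm_apply]⟩
  hom_inv_id := IIOAL.Hom.ext (DFunLike.ext _ _ e.symm_apply_apply)
  inv_hom_id := IIOAL.Hom.ext (DFunLike.ext _ _ e.apply_symm_apply)

instance : SOLC.toIIOAL.{u}.EssSurj where
  mem_essImage X := ⟨Opposite.op ⟨DualSpace X.isMVDAlgebra⟩,
    ⟨(IIOAL.isoOfOrderIso (Y := SOLC.regOpens ⟨DualSpace X.isMVDAlgebra⟩)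
      (DualSpace.orderIso X.isMVDAlgebra) fun _ _ => DualSpace.ll_orderIso_iff).symm⟩⟩

instance : SOLC.toIIOAL.{u}.IsEquivalence where

/-- The categories `IOAL` and `IIOAL` are isomorphic, and `IIOAL` is dually equivalent to the
category `SOLC` of locally compact Hausdorff spaces and surjective open maps. -/
theorem mainTheorem10 :
    (∃ (K : IOAL.{u} ⥤ IIOAL.{u}) (Θ : IIOAL.{u} ⥤ IOAL.{u}),
      K ⋙ Θ = 𝟭 IOAL.{u} ∧ Θ ⋙ K = 𝟭 IIOAL.{u}) ∧
    Nonempty (SOLC.{u}ᵒᵖ ≌ IIOAL.{u}) :=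
  ⟨⟨IOAL.toIIOAL, IIOAL.toIOAL, IOAL.toIIOAL_comp_toIOAL, IIOAL.toIOAL_comp_toIIOAL⟩,
    ⟨SOLC.toIIOAL.asEquivalence⟩⟩
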